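/- Let $K$ be a field, $L$ a finite cyclic Galois extension of $K$ of degree $n$, and $\sigma$ a generator of $\mathrm{Gal}(L/K)$. Let $L[x;\sigma]$ be the skew polynomial ring, whose elements are the polynomials $\sum_i a_i x^i$ with $a_i\in L$, with the usual addition and with the multiplication determined by $xa=\sigma(a)x$ for $a\in L$. Let $N:L\to K$, $N(a)=\prod_{i=0}^{n-1}\sigma^i(a)$, be the norm map. Let $F\in K[y]$ be a monic irreducible polynomial of degree $s$ with constant coefficient $F_0$, let $k\ge 0$ be an integer, and let $g\in L[x;\sigma]$ be a monic polynomial of degree $sk$ with constant coefficient $g_0$ such that $F(x^n)=hg$ for some $h\in L[x;\sigma]$. Then $$N(g_0)=(-1)^{ks(n-1)}F_0^{\,k}.$$ -/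

import Mathlib

noncomputable section

/-- The action of `ℕ` on `L` in which `i` acts as the `i`-th power of `σ`. -/
abbrev twistAction {K L : Type*} [Field K] [Field L] [Algebra K L] (σ : L ≃ₐ[K] L) :
    MulSemiringAction (Multiplicative ℕ) L :=
  MulSemiringAction.compHom L (powersHom (L ≃ₐ[K] L) σ)

/-- The skew polynomial ring `L[x;σ]`: finite sums `∑ aᵢ xⁱ` with `aᵢ ∈ L`, coefficientwise
addition, and the multiplication determined by `x a = σ(a) x`. -/
def SkewPolyRing {K L : Type*} [Field K] [Field L] [Algebra K L] (_σ : L ≃ₐ[K] L) : Type _ :=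
  SkewPolynomial L

namespace SkewPolyRing

variable {K L : Type*} [Field K] [Field L] [Algebra K L] {σ : L ≃ₐ[K] L}

instance instRing (σ : L ≃ₐ[K] L) : Ring (SkewPolyRing σ) :=
  letI := twistAction σ
  inferInstanceAs (Ring (SkewPolynomial L))

/-- The coefficient of `xⁱ`. -/
def coeff (g : SkewPolyRing σ) (i : ℕ) : L := SkewPolynomial.coeff g i

/-- The degree (with value `0` at the zero polynomial). -/
def natDegree (g : SkewPolyRing σ) : ℕ := (SkewPolynomial.support g).sup id

/-- `g` is monic: its leading coefficient is `1`. -/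
def Monic (g : SkewPolyRing σ) : Prop := g.coeff g.natDegree = 1

/-- The embedding of `L` as the constants of `L[x;σ]`. -/
def C (σ : L ≃ₐ[K] L) : L →+* SkewPolyRing σ :=
  letI := twistAction σ
  SkewPolynomial.CRingHom

/-- The indeterminate `x`. -/
def X (σ : L ≃ₐ[K] L) : SkewPolyRing σ := (SkewPolynomial.X : SkewPolynomial L)

/-- For `F ∈ K[y]`, the element `F(xⁿ)` of `L[x;σ]`. -/
def evalXPow (σ : L ≃ₐ[K] L) (n : ℕ) (F : Polynomial K) : SkewPolyRing σ :=
  F.eval₂ ((C σ).comp (algebraMap K L)) (X σ ^ n)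

/-- `g` is a right divisor of `f`: `f = h g` for some `h`. -/
def IsRightDivisor (g f : SkewPolyRing σ) : Prop := ∃ h : SkewPolyRing σ, f = h * g

/-- The commutation rule of `L[x;σ]`. -/
theorem X_mul_C (σ : L ≃ₐ[K] L) (a : L) : X σ * C σ a = C σ (σ a) * X σ := by
  let _ := twistAction σ
  have key : (SkewPolynomial.X * SkewPolynomial.C a : SkewPolynomial L)
      = SkewPolynomial.C (σ a) * SkewPolynomial.X := by
    rw [← SkewPolynomial.monomial_zero_left, ← SkewPolynomial.monomial_zero_left,
      SkewPolynomial.X_mul_monomial, SkewPolynomial.monomial_mul_X]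
    congr 1
  exact key

end SkewPolyRing

end

/-! Let $x$ act as $t$ times the cyclic shift and $a\in L$ as the diagonal of its conjugates; since
$\sigma^n=1$, this gives a multiplicative map to $n\times n$ matrices over $L[t]$
(`regularMatrix_mul`). Its determinant, the reduced norm, has the form $G(t^n)$ with $G\in K[y]$
(`exists_reducedNorm_eq`). As $F(x^n)$ becomes the scalar $F(t^n)$, of norm $F(t^n)^n$,
multiplicativity yields $G\mid F^n$, so $G=cF^j$ by irreducibility. The top coefficient of $G$ is
the sign of a power of the shift; this fixes $c$, and the degree gives $j=k$. The constant term of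
$G$ is $N(g_0)$. -/

/-! ### Determinants of polynomial matrices and signs of cyclic shifts. -/

open Polynomial in
theorem Polynomial.natDegree_det_le_of_forall {R ι : Type*} [CommRing R] [Fintype ι]
    [DecidableEq ι] (M : Matrix ι ι R[X]) (d : ℕ) (h : ∀ i j, (M i j).natDegree ≤ d) :
    M.det.natDegree ≤ Fintype.card ι * d := by
  rw [Matrix.det_apply]
  refine natDegree_sum_le_of_forall_le _ _ fun τ _ => ?_
  refine (natDegree_smul_le _ _).trans ((natDegree_prod_le _ _).trans ?_)
  exact (Finset.sum_le_card_nsmul _ _ d fun i _ => h _ _).trans (by simp)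

open Polynomial in
theorem Polynomial.coeff_det_of_natDegree_le {R ι : Type*} [CommRing R] [Fintype ι]
    [DecidableEq ι] (M : Matrix ι ι R[X]) (d : ℕ) (h : ∀ i j, (M i j).natDegree ≤ d) :
    M.det.coeff (Fintype.card ι * d) = (M.map (coeff · d)).det := by
  rw [Matrix.det_apply, Matrix.det_apply, finsetSum_coeff]
  refine Finset.sum_congr rfl fun τ _ => ?_
  rw [Units.smul_def, Units.smul_def, coeff_smul,
    ← Finset.card_univ, coeff_prod_of_natDegree_le _ _ _ fun i _ => h _ _]
  rfl

open Polynomial in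
/-- A product of polynomials supported in fixed residue classes of degrees is supported in
the sum of these classes. -/
theorem Polynomial.natCast_eq_sum_of_coeff_prod_ne_zero {R A ι : Type*} [CommRing R]
    [AddCommMonoidWithOne A] (t : Finset ι) (f : ι → R[X]) (r : ι → A)
    (h : ∀ i ∈ t, ∀ j, (f i).coeff j ≠ 0 → (j : A) = r i) (j : ℕ)
    (hj : (∏ i ∈ t, f i).coeff j ≠ 0) : (j : A) = ∑ i ∈ t, r i := by
  classical
  induction t using Finset.induction_on generalizing j with
  | empty =>
    rw [Finset.prod_empty, coeff_one] at hj
    have : j = 0 := by by_contra h0; exact hj (if_neg h0)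
    simp [this]
  | insert a t ha ih =>
    rw [Finset.prod_insert ha, coeff_mul] at hj
    obtain ⟨p, hp, hne⟩ := Finset.exists_ne_zero_of_sum_ne_zero hj
    rw [Finset.sum_insert ha, ← Finset.HasAntidiagonal.mem_antidiagonal.1 hp, Nat.cast_add,
      h a (Finset.mem_insert_self a t) _ (left_ne_zero_of_mul hne),
      ih (fun i hi => h i (Finset.mem_insert_of_mem hi)) _ (right_ne_zero_of_mul hne)]

theorem ZMod.sign_addRight_one (n : ℕ) [NeZero n] :
    Equiv.Perm.sign (Equiv.addRight (1 : ZMod n)) = (-1) ^ (n - 1) := by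
  obtain _ | m := n
  · exact absurd rfl (NeZero.ne 0)
  -- `ZMod (m + 1)` unfolds to `Fin (m + 1)`, where adding one is the full cycle `finRotate`.
  · rw [← sign_finRotate]
    congr 1
    refine Equiv.ext fun i => ?_
    exact (finRotate_apply (n := m + 1) i).symm

theorem ZMod.sign_addRight_natCast (n : ℕ) [NeZero n] (d : ℕ) :
    Equiv.Perm.sign (Equiv.addRight (d : ZMod n)) = (-1) ^ (d * (n - 1)) := by
  rw [mul_comm, pow_mul, ← ZMod.sign_addRight_one, ← map_pow]
  congr 1
  ext i
  simp

/-! ### Coefficients in the skew polynomial ring. -/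

namespace SkewPolyRing

variable {K L : Type*} [Field K] [Field L] [Algebra K L] {σ : L ≃ₐ[K] L}

theorem coeff_add (g h : SkewPolyRing σ) (j : ℕ) : (g + h).coeff j = g.coeff j + h.coeff j := by
  let _ := twistAction σ
  exact congrArg (· (Multiplicative.ofAdd j)) (SkewMonoidAlgebra.coeff_add (k := L) g h)

theorem coeff_mul (h g : SkewPolyRing σ) (m : ℕ) :
    (h * g).coeff m =
      ∑ p ∈ Finset.HasAntidiagonal.antidiagonal m, h.coeff p.1 * (σ ^ p.1) (g.coeff p.2) := by
  let _ := twistAction σ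
  refine (SkewMonoidAlgebra.coeff_mul_antidiagonal_of_finset (k := L) h g
    (Multiplicative.ofAdd m) (Finset.HasAntidiagonal.antidiagonal (A := ℕ) m) ?_).trans rfl
  intro p
  exact Finset.HasAntidiagonal.mem_antidiagonal (A := ℕ)

theorem coeff_C_mul_X_pow (a : L) (e j : ℕ) :
    (C σ a * X σ ^ e).coeff j = if e = j then a else 0 := by
  let _ := twistAction σ
  have h : (SkewPolynomial.C a * SkewPolynomial.X ^ e : SkewPolynomial L)
      = SkewPolynomial.monomial e a := SkewPolynomial.C_mul_X_pow_eq_monomial (R := L) (a := a) (n := e)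
  exact (congrArg (SkewPolynomial.coeff · j) h).trans SkewPolynomial.coeff_monomial

theorem coeff_evalXPow (n : ℕ) (F : Polynomial K) (j : ℕ) :
    (evalXPow σ n F).coeff j = ((Polynomial.expand L n) (F.map (algebraMap K L))).coeff j := by
  induction F using Polynomial.induction_on' with
  | add p q hp hq =>
    rw [Polynomial.map_add, map_add, Polynomial.coeff_add, ← hp, ← hq, ← coeff_add]
    exact congrArg (coeff · j) (Polynomial.eval₂_add _ _)
  | monomial e a =>
    rw [evalXPow, Polynomial.eval₂_monomial, ← pow_mul, Polynomial.map_monomial,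
      Polynomial.expand_monomial, Polynomial.coeff_monomial]
    exact (coeff_C_mul_X_pow _ _ _).trans (by rw [mul_comm])

theorem coeff_eq_zero_of_natDegree_lt (g : SkewPolyRing σ) {j : ℕ} (hj : g.natDegree < j) :
    g.coeff j = 0 := by
  by_contra h
  exact absurd (Finset.le_sup (f := id) (SkewPolynomial.mem_support_iff.2 h)) (not_le.2 hj)

/-! ### The matrix representation and the reduced norm. -/

/-- The matrix over `L[t]` of right multiplication by `g`, where `x` acts as `t` times a cyclic
shift and `a ∈ L` acts as the diagonal matrix of its conjugates. -/
noncomputable def regularMatrix (n : ℕ) (g : SkewPolyRing σ) : Matrix (ZMod n) (ZMod n) (Polynomial L) :=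
  fun i l => ∑ j ∈ Finset.range (g.natDegree + 1),
    if (j : ZMod n) = l - i then Polynomial.monomial j ((σ ^ i.val) (g.coeff j)) else 0

theorem coeff_regularMatrix (n : ℕ) (g : SkewPolyRing σ) (i l : ZMod n) (j : ℕ) :
    (regularMatrix n g i l).coeff j =
      if (j : ZMod n) = l - i then (σ ^ i.val) (g.coeff j) else 0 := by
  rw [regularMatrix, Polynomial.finsetSum_coeff, Finset.sum_eq_single j]
  · split_ifs <;> simp
  · intro b _ hb
    split_ifs <;> simp [Polynomial.coeff_monomial, hb]
  · intro hj
    rw [coeff_eq_zero_of_natDegree_lt g (by simpa using hj)]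
    simp

theorem natDegree_regularMatrix_le (n : ℕ) (g : SkewPolyRing σ) (i l : ZMod n) :
    (regularMatrix n g i l).natDegree ≤ g.natDegree := by
  refine Polynomial.natDegree_le_iff_coeff_eq_zero.2 fun j hj => ?_
  rw [coeff_regularMatrix, coeff_eq_zero_of_natDegree_lt g hj]
  simp

theorem pow_val_add {n : ℕ} [NeZero n] (hσ : orderOf σ = n) (i : ZMod n) (a : ℕ) :
    σ ^ (i + a : ZMod n).val = σ ^ (i.val + a) := by
  rw [pow_eq_pow_iff_modEq, hσ, ← ZMod.natCast_eq_natCast_iff]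
  simp

theorem regularMatrix_mul {n : ℕ} [NeZero n] (hσ : orderOf σ = n) (h g : SkewPolyRing σ) :
    regularMatrix n (h * g) = regularMatrix n h * regularMatrix n g := by
  ext i l m
  simp only [Matrix.mul_apply, Polynomial.finsetSum_coeff, Polynomial.coeff_mul,
    coeff_regularMatrix, SkewPolyRing.coeff_mul]
  rw [Finset.sum_comm, map_sum, Finset.ite_sum_zero]
  refine Finset.sum_congr rfl fun p hp => ?_
  have hm : (m : ZMod n) = p.1 + p.2 := by
    rw [← Finset.HasAntidiagonal.mem_antidiagonal.1 hp, Nat.cast_add]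
  -- A term of degree `p.1` in row `i` lies only in column `i + p.1`, so one intermediate index
  -- survives.
  rw [Finset.sum_eq_single (i + p.1)]
  · have e : ((p.2 : ZMod n) = l - (i + p.1)) ↔ (m : ZMod n) = l - i := by
      rw [hm]
      constructor <;> intro h <;> linear_combination h
    rw [if_pos (add_sub_cancel_left i (p.1 : ZMod n)).symm]
    simp only [e]
    split_ifs
    · rw [map_mul, pow_val_add hσ, pow_add, AlgEquiv.mul_apply]
    · simp
  · intro b _ hb
    rw [if_neg, zero_mul]
    intro h
    exact hb (by rw [h]; ring)
  · simp

/-- The reduced norm of `g`, as a polynomial in `t`, where `y = tⁿ`. -/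
noncomputable def reducedNorm (n : ℕ) [NeZero n] (g : SkewPolyRing σ) : Polynomial L :=
  (regularMatrix n g).det

theorem reducedNorm_mul {n : ℕ} [NeZero n] (hσ : orderOf σ = n) (h g : SkewPolyRing σ) :
    reducedNorm n (h * g) = reducedNorm n h * reducedNorm n g := by
  rw [reducedNorm, regularMatrix_mul hσ, Matrix.det_mul, reducedNorm, reducedNorm]

theorem reducedNorm_evalXPow (n : ℕ) [NeZero n] (F : Polynomial K) :
    reducedNorm n (evalXPow σ n F) = Polynomial.expand L n ((F ^ n).map (algebraMap K L)) := by
  have hn : 0 < n := NeZero.pos n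
  have h : regularMatrix n (evalXPow σ n F)
      = Matrix.diagonal fun _ => Polynomial.expand L n (F.map (algebraMap K L)) := by
    ext i l j
    rw [coeff_regularMatrix, coeff_evalXPow, Polynomial.coeff_expand hn]
    by_cases hj : n ∣ j
    · rw [if_pos hj, Polynomial.coeff_map, AlgEquiv.commutes, (ZMod.natCast_eq_zero_iff j n).2 hj]
      by_cases hil : i = l
      · simp [hil, Polynomial.coeff_expand hn, hj]
      · rw [if_neg fun h => hil (sub_eq_zero.1 h.symm).symm, Matrix.diagonal_apply_ne _ hil,
          Polynomial.coeff_zero]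
    · by_cases hil : i = l
      · simp [hil, Polynomial.coeff_expand hn, hj]
      · simp [hj, Matrix.diagonal_apply_ne _ hil]
  rw [reducedNorm, h, Matrix.det_diagonal, Finset.prod_const, Finset.card_univ, ZMod.card,
    Polynomial.map_pow, map_pow]

/-- In top degree $d$ only the leading coefficients 1 remain, leaving the permutation matrix of the
shift by $d$. -/
theorem coeff_reducedNorm_of_monic (n : ℕ) [NeZero n] (g : SkewPolyRing σ) (hg : g.Monic) :
    (reducedNorm n g).coeff (n * g.natDegree) = (-1) ^ (g.natDegree * (n - 1)) := by
  have h := Polynomial.coeff_det_of_natDegree_le _ _ (natDegree_regularMatrix_le n g)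
  rw [ZMod.card] at h
  have hM : (regularMatrix n g).map (Polynomial.coeff · g.natDegree)
      = (Equiv.addRight (g.natDegree : ZMod n)).permMatrix L := by
    ext i l
    have hg' : g.coeff g.natDegree = 1 := hg
    rw [Matrix.map_apply, coeff_regularMatrix, hg', map_one, Equiv.Perm.permMatrix,
      PEquiv.toMatrix_apply]
    refine if_congr ?_ rfl rfl
    simp only [Equiv.toPEquiv_apply, Option.mem_def, Option.some.injEq, Equiv.coe_addRight]
    rw [eq_sub_iff_add_eq, add_comm]
  rw [reducedNorm, h, hM, Matrix.det_permutation, ZMod.sign_addRight_natCast]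
  simp

theorem natDegree_reducedNorm_le (n : ℕ) [NeZero n] (g : SkewPolyRing σ) :
    (reducedNorm n g).natDegree ≤ n * g.natDegree := by
  have h := Polynomial.natDegree_det_le_of_forall _ _ (natDegree_regularMatrix_le n g)
  rwa [ZMod.card] at h

/-- At $t=0$ only the diagonal of conjugates survives. -/
theorem coeff_zero_reducedNorm (n : ℕ) [NeZero n] (g : SkewPolyRing σ) :
    (reducedNorm n g).coeff 0 = ∏ i : ZMod n, (σ ^ i.val) (g.coeff 0) := by
  have h : Polynomial.constantCoeff.mapMatrix (regularMatrix n g)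
      = Matrix.diagonal fun i : ZMod n => (σ ^ i.val) (g.coeff 0) := by
    ext i l
    rw [RingHom.mapMatrix_apply, Matrix.map_apply, Polynomial.constantCoeff_apply,
      coeff_regularMatrix, Matrix.diagonal_apply]
    refine if_congr ?_ rfl rfl
    rw [Nat.cast_zero, eq_comm, sub_eq_zero, eq_comm]
  rw [reducedNorm, ← Polynomial.constantCoeff_apply, RingHom.map_det, h, Matrix.det_diagonal]

/-- Applying $\sigma$ to the entries amounts to shifting both indices by one, which preserves the
determinant. -/
theorem map_reducedNorm {n : ℕ} [NeZero n] (hσ : orderOf σ = n) (g : SkewPolyRing σ) :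
    (reducedNorm n g).map (σ : L →+* L) = reducedNorm n g := by
  have h : (Polynomial.mapRingHom (σ : L →+* L)).mapMatrix (regularMatrix n g)
      = (regularMatrix n g).submatrix (Equiv.addRight 1) (Equiv.addRight 1) := by
    ext i l j
    have hp := pow_val_add hσ i 1
    rw [Nat.cast_one, add_comm i.val, pow_add, pow_one] at hp
    simp only [RingHom.mapMatrix_apply, Matrix.map_apply, Polynomial.coe_mapRingHom,
      Polynomial.coeff_map, Matrix.submatrix_apply, coeff_regularMatrix, Equiv.coe_addRight,
      add_sub_add_right_eq_sub, hp]
    split_ifs <;> simp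
  rw [reducedNorm, ← Polynomial.coe_mapRingHom, RingHom.map_det, h,
    Matrix.det_submatrix_equiv_self]

/-- In the Leibniz product for $\tau$, exponents are congruent mod $n$ to $\sum_i (i-\tau i)=0$. -/
theorem dvd_of_coeff_reducedNorm_ne_zero (n : ℕ) [NeZero n] (g : SkewPolyRing σ) (j : ℕ)
    (hj : (reducedNorm n g).coeff j ≠ 0) : n ∣ j := by
  rw [reducedNorm, Matrix.det_apply, Polynomial.finsetSum_coeff] at hj
  obtain ⟨τ, _, hτ⟩ := Finset.exists_ne_zero_of_sum_ne_zero hj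
  rw [Units.smul_def, Polynomial.coeff_smul] at hτ
  have h := Polynomial.natCast_eq_sum_of_coeff_prod_ne_zero Finset.univ
    (fun i => regularMatrix n g (τ i) i) (fun i => i - τ i) (fun i _ m hm => by
      rw [coeff_regularMatrix] at hm
      by_contra h
      exact hm (if_neg h)) j (right_ne_zero_of_smul hτ)
  rw [Finset.sum_sub_distrib, Equiv.sum_comp τ (fun i => i), sub_self] at h
  exact (ZMod.natCast_eq_zero_iff j n).1 h

/-! ### Galois descent to $K$. -/

theorem orderOf_eq_finrank [FiniteDimensional K L] [IsGalois K L]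
    (hσ : ∀ τ : L ≃ₐ[K] L, τ ∈ Subgroup.zpowers σ) : orderOf σ = Module.finrank K L := by
  rw [orderOf_eq_card_of_forall_mem_zpowers hσ, IsGalois.card_aut_eq_finrank]

theorem mem_range_algebraMap_of_apply_eq [FiniteDimensional K L] [IsGalois K L]
    (hσ : ∀ τ : L ≃ₐ[K] L, τ ∈ Subgroup.zpowers σ) {a : L} (ha : σ a = a) :
    a ∈ Set.range (algebraMap K L) := by
  rw [IsGalois.mem_range_algebraMap_iff_fixed]
  intro τ
  have h : Subgroup.zpowers σ ≤ MulAction.stabilizer (L ≃ₐ[K] L) a :=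
    Subgroup.zpowers_le.2 ha
  exact h (hσ τ)

theorem exists_reducedNorm_eq [FiniteDimensional K L] [IsGalois K L] {n : ℕ} [NeZero n]
    (hn : Module.finrank K L = n) (hσ : ∀ τ : L ≃ₐ[K] L, τ ∈ Subgroup.zpowers σ)
    (g : SkewPolyRing σ) :
    ∃ G : Polynomial K, reducedNorm n g = Polynomial.expand L n (G.map (algebraMap K L)) := by
  have hmap := map_reducedNorm ((orderOf_eq_finrank hσ).trans hn) g
  -- Contraction replaces $t^n$ by $y$; it loses nothing, as the other exponents do not occur.
  have hlift : Polynomial.contract n (reducedNorm n g) ∈ Polynomial.lifts (algebraMap K L) := by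
    rw [Polynomial.lifts_iff_coeff_lifts]
    intro j
    rw [Polynomial.coeff_contract (NeZero.ne n)]
    refine mem_range_algebraMap_of_apply_eq hσ ?_
    conv_rhs => rw [← hmap]
    rw [Polynomial.coeff_map]
    rfl
  obtain ⟨G, hG⟩ := (Polynomial.mem_lifts _).1 hlift
  refine ⟨G, ?_⟩
  ext j
  rw [hG, Polynomial.coeff_expand (NeZero.pos n), Polynomial.coeff_contract (NeZero.ne n)]
  split_ifs with h
  · rw [Nat.div_mul_cancel h]
  · by_contra hj
    exact h (dvd_of_coeff_reducedNorm_ne_zero n g j hj)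

theorem prod_pow_val_eq_norm [FiniteDimensional K L] [IsGalois K L] {n : ℕ} [NeZero n]
    (hn : Module.finrank K L = n) (hσ : ∀ τ : L ≃ₐ[K] L, τ ∈ Subgroup.zpowers σ) (a : L) :
    ∏ i : ZMod n, (σ ^ i.val) a = algebraMap K L (Algebra.norm K a) := by
  have ho := (orderOf_eq_finrank hσ).trans hn
  rw [Algebra.norm_eq_prod_automorphisms]
  refine Fintype.prod_bijective (fun i : ZMod n => σ ^ i.val) ?_ _ _ fun _ => rfl
  rw [Fintype.bijective_iff_injective_and_card]
  constructor
  · intro i j hij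
    have h := pow_eq_pow_iff_modEq.1 hij
    rw [ho, ← ZMod.natCast_eq_natCast_iff] at h
    simpa using h
  · rw [ZMod.card, ← Nat.card_eq_fintype_card, IsGalois.card_aut_eq_finrank, hn]

end SkewPolyRing

theorem mainTheorem8 {K L : Type*} [Field K] [Field L] [Algebra K L]
    [FiniteDimensional K L] [IsGalois K L]
    (n : ℕ) (hn : Module.finrank K L = n)
    (σ : L ≃ₐ[K] L) (hσ : ∀ τ : L ≃ₐ[K] L, τ ∈ Subgroup.zpowers σ)
    (F : Polynomial K) (hFmonic : F.Monic) (hFirr : Irreducible F)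
    (s : ℕ) (hs : F.natDegree = s) (k : ℕ)
    (g : SkewPolyRing σ) (hgmonic : g.Monic) (hgdeg : g.natDegree = s * k)
    (hgdvd : g.IsRightDivisor (SkewPolyRing.evalXPow σ n F)) :
    Algebra.norm K (g.coeff 0) = (-1) ^ (k * s * (n - 1)) * F.coeff 0 ^ k := by
  have hnpos : 0 < n := hn ▸ Module.finrank_pos
  have : NeZero n := ⟨hnpos.ne'⟩
  have hinj := (algebraMap K L).injective
  obtain ⟨h, hh⟩ := hgdvd
  obtain ⟨G, hG⟩ := SkewPolyRing.exists_reducedNorm_eq hn hσ g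
  obtain ⟨H, hH⟩ := SkewPolyRing.exists_reducedNorm_eq hn hσ h
  have hdvd : G ∣ F ^ n := by
    refine ⟨H, Polynomial.map_injective _ hinj (Polynomial.expand_injective hnpos ?_)⟩
    rw [← SkewPolyRing.reducedNorm_evalXPow (σ := σ), hh,
      SkewPolyRing.reducedNorm_mul ((SkewPolyRing.orderOf_eq_finrank hσ).trans hn), hG, hH,
      Polynomial.map_mul, map_mul, mul_comm]
  have hlead : G.coeff (s * k) = (-1) ^ (k * s * (n - 1)) := by
    have h1 := SkewPolyRing.coeff_reducedNorm_of_monic n g hgmonic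
    rw [hG, hgdeg, mul_comm n, Polynomial.coeff_expand_mul hnpos, Polynomial.coeff_map] at h1
    exact hinj (by rw [h1, mul_comm k s]; simp)
  have hdeg : G.natDegree = s * k := by
    refine Polynomial.natDegree_eq_of_le_of_coeff_ne_zero ?_ (by rw [hlead]; simp)
    have h1 := SkewPolyRing.natDegree_reducedNorm_le n g
    rw [hG, hgdeg, Polynomial.natDegree_expand, Polynomial.natDegree_map, mul_comm] at h1
    exact Nat.le_of_mul_le_mul_left h1 hnpos
  obtain ⟨j, -, hj⟩ := (dvd_prime_pow hFirr.prime n).1 hdvd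
  obtain ⟨u, hu⟩ := hj.symm
  obtain ⟨c, -, hc⟩ := Polynomial.isUnit_iff.1 u.isUnit
  have hGF : G = F ^ j * Polynomial.C c := by rw [hc, hu]
  have hc0 : c ≠ 0 := by
    rintro rfl
    exact u.ne_zero (by rw [← hc, Polynomial.C_0])
  have hspos : 0 < s := hs ▸ hFirr.natDegree_pos
  -- Both sides of $G=cF^j$ have degree $sk$, and $s>0$ can be cancelled.
  have hjk : j = k := by
    rw [hGF, Polynomial.natDegree_mul_C hc0, hFmonic.natDegree_pow, hs, mul_comm] at hdeg
    exact Nat.eq_of_mul_eq_mul_left hspos hdeg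
  subst hjk
  have hcs : c = (-1) ^ (j * s * (n - 1)) := by
    have h1 := (hFmonic.pow j).coeff_natDegree
    rw [hFmonic.natDegree_pow, hs, mul_comm] at h1
    rw [← hlead, hGF, Polynomial.coeff_mul_C, h1, one_mul]
  have hzero := SkewPolyRing.coeff_zero_reducedNorm n g
  rw [SkewPolyRing.prod_pow_val_eq_norm hn hσ, hG, ← zero_mul n,
    Polynomial.coeff_expand_mul hnpos, Polynomial.coeff_map] at hzero
  rw [zero_mul] at hzero
  rw [← hinj hzero, hGF, Polynomial.coeff_mul_C, hcs, mul_comm, Polynomial.coeff_zero_eq_eval_zero,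
    Polynomial.eval_pow, Polynomial.coeff_zero_eq_eval_zero]
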